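/- Let $\mathcal A$ be a complete Boolean algebra and let $V^{(\mathcal A)}$ be the associated Boolean-valued universe, with Boolean truth values $[\![\cdot]\!]$. For names $x,y$ write $x\sim y$ if $[\![x=y]\!]=1$. A *partition of $1$* is a family $(a_i)_{i\in I}$ in $\mathcal A$ with $\bigvee_i a_i=1$ and $a_i\wedge a_j=0$ for $i\ne j$. A *conditional set* over $\mathcal A$ consists of a non-empty set $X$, a set $\mathbf X$ and a surjection $X\times\mathcal A\to\mathbf X$, $(x,a)\mapsto x|a$, such that (1) $x|a=y|b$ implies $a=b$; (2) if $a\le b$ and $x|b=y|b$, then $x|a=y|a$; (3) for every partition $(a_i)_{i\in I}$ of $1$ and every family $(x_i)_{i\in I}$ in $X$ there is a unique $x\in X$ with $x|a_i=x_i|a_i$ for all $i$, denoted $\sum x_i|a_i$. A *conditional function* $\mathbf f:\mathbf X\to\mathbf Y$ is given by a stable function $f:X\to Y$, i.e. one with $f(\sum x_i|a_i)=\sum f(x_i)|a_i$ for all partitions $(a_i)$ of $1$ and all families $(x_i)$ in $X$ (equivalently, by its conditional graph $\{(x|a,f(x)|a): x\in X,\ a\in\mathcal A\}$). Let $\mathcal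 C$ be the category of conditional sets over $\mathcal A$ and conditional functions. Let $\mathcal N$ be the category whose objects are the $x\in V^{(\mathcal A)}$ with $[\![x\neq\emptyset]\!]=1$ and whose morphisms $x\to y$ are the names $f$ with $[\![f\text{ is a function from }x\text{ to }y]\!]=1$, two such names being identified if $f\sim g$; identities and composition are those of functions inside $V^{(\mathcal A)}$. **Descent.** For an object $x$ of $\mathcal N$ let $x{\downarrow}$ be the set of names $u$ with $[\![u\in x]\!]=1$, one from each class modulo $\sim$, and let $G(x)$ be the conditional set with underlying set $x{\downarrow}$ obtained as the quotient of $x{\downarrow}\times\mathcal A$ by the relation $(u,a)\sim(v,b)$ iff $a=b$ and $[\![u=v]\!]\ge a$, where $u|a$ is the class of $(u,a)$. For a morphism $f:x\to y$ let $G(f)$ be the conditional function given by the stable function $f{\downarrow}:x{\downarrow}\to y{\downarrow}$ determined by $[\![f{\downarrow}(u)=f(u)]\!]=1$. **Names of conditional sets.** Regard the elements of the underlying sets $X$ of conditional sets as sets of the universe $V$ (by an arbitrary choice of an injection $X\to V$ for each conditional set), with canonical names $\check v$. For a conditional set $\mathbf X$ and $u,v\in X$ let $a_{u,v}=\bigvee\{b\in\mathcal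 A: u|b=v|b\}$, let $\bar u$ be the name with domain $\{\check v: v\in X\}$ and $\bar u(\check v)=a_{u,v}$, and let $H(\mathbf X)=\tilde X$ be the name with domain $\{\bar u:u\in X\}$ and $\tilde X(\bar u)=1$. For a conditional function $\mathbf f:\mathbf X\to\mathbf Y$ let $H(\mathbf f)$ be the class of the name whose domain consists of the canonical names of the pairs $(\bar u,\overline{f(u)})$, $u\in X$, in $V^{(\mathcal A)}$, all with value $1$. **Theorem.** $G:\mathcal N\to\mathcal C$ and $H:\mathcal C\to\mathcal N$ are well-defined functors and they are mutually quasi-inverse equivalences of categories: there is an equivalence between $\mathcal N$ and $\mathcal C$ whose two functors are $G$ and $H$. -/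

import Mathlib

open CategoryTheory

universe u

namespace BVM

/-! ### Names and Boolean truth values -/

/-- The Boolean-valued universe `V^(A)`: a name is a set-indexed family of names (its domain)
together with a value in `A` attached to each member of the domain. -/
inductive BName (A : Type u) : Type (u + 1)
  | mk (ι : Type u) (dom : ι → BName A) (val : ι → A) : BName A

namespace BName

/-- The index type of the domain of a name. -/
def Idx {A : Type u} : BName A → Type u
  | mk ι _ _ => ι

/-- The members of the domain of a name. -/
def dom {A : Type u} : (x : BName A) → x.Idx → BName A
  | mk _ d _ => d

/-- The Boolean values attached to the members of the domain. -/
def val {A : Type u} : (x : BName A) → x.Idx → A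
  | mk _ _ v => v

end BName

/-- The truth value `[[x = y]]`; see `beq_unfold` for the usual form of the recursion. -/
def beq {A : Type u} [CompleteBooleanAlgebra A] : BName A → BName A → A
  | BName.mk ι x b, BName.mk κ y c =>
    (⨅ i : ι, b i ⇨ ⨆ j : κ, c j ⊓ beq (x i) (y j)) ⊓
      (⨅ j : κ, c j ⇨ ⨆ i : ι, b i ⊓ beq (x i) (y j))

/-- The truth value `[[x ∈ y]] = ⨆_{t ∈ dom y} y(t) ⊓ [[t = x]]`. -/
def mem {A : Type u} [CompleteBooleanAlgebra A] (x y : BName A) : A :=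
  ⨆ j : y.Idx, y.val j ⊓ beq (y.dom j) x

section Basic

variable {A : Type u} [CompleteBooleanAlgebra A]

theorem beq_symm (x y : BName A) : beq x y = beq y x := by
  induction x generalizing y with
  | mk ι x b ih =>
    cases y with
    | mk κ y c =>
      simp only [beq]
      rw [inf_comm]
      simp only [ih]

/-- `[[x = y]]` in the usual form:
`⨅_{t ∈ dom x} (x(t) ⇒ [[t ∈ y]]) ⊓ ⨅_{t ∈ dom y} (y(t) ⇒ [[t ∈ x]])`. -/
theorem beq_unfold (x y : BName A) :
    beq x y = (⨅ i : x.Idx, x.val i ⇨ mem (x.dom i) y) ⊓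
      (⨅ j : y.Idx, y.val j ⇨ mem (y.dom j) x) := by
  cases x with
  | mk ι x b =>
    cases y with
    | mk κ y c =>
      simp only [beq, mem, BName.dom, BName.val, BName.Idx, beq_symm (y _) (x _)]

theorem beq_refl (x : BName A) : beq x x = ⊤ := by
  induction x with
  | mk ι x b ih =>
    simp only [beq, inf_eq_top_iff, iInf_eq_top, himp_eq_top_iff]
    constructor <;> intro i <;> refine le_iSup_of_le i ?_ <;> simp [ih]

theorem val_le_mem (x : BName A) (i : x.Idx) : x.val i ≤ mem (x.dom i) x :=
  le_iSup_of_le i (by simp [beq_refl])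

theorem or_elim {G a b c : A} (h : G ≤ a ⊔ b) (h1 : G ⊓ a ≤ c) (h2 : G ⊓ b ≤ c) : G ≤ c := by
  have : G ≤ (G ⊓ a) ⊔ (G ⊓ b) := by rw [← inf_sup_left]; exact le_inf le_rfl h
  exact this.trans (sup_le h1 h2)

theorem ex_elim {ι : Sort*} {G c : A} {f : ι → A} (h : G ≤ ⨆ i, f i)
    (h1 : ∀ i, G ⊓ f i ≤ c) : G ≤ c := by
  have : G ≤ ⨆ i, G ⊓ f i := by rw [← inf_iSup_eq]; exact le_inf le_rfl h
  exact this.trans (iSup_le h1)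

theorem beq_le_left (x y : BName A) (i : x.Idx) : beq x y ⊓ x.val i ≤ mem (x.dom i) y := by
  rw [beq_unfold, ← le_himp_iff]
  exact inf_le_left.trans (iInf_le _ i)

theorem beq_symm' {G : A} {x y : BName A} (h : G ≤ beq x y) : G ≤ beq y x := by
  rwa [beq_symm]

theorem beq_trans (x y z : BName A) : beq x y ⊓ beq y z ≤ beq x z := by
  induction x generalizing y z with
  | mk ι xd xv ih =>
    have key : ∀ i : ι, beq (BName.mk ι xd xv) y ⊓ beq y z ⊓ xv i ≤ mem (xd i) z := by
      intro i
      have h1 : beq (BName.mk ι xd xv) y ⊓ beq y z ⊓ xv i ≤ mem (xd i) y :=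
        le_trans (inf_le_inf_right _ inf_le_left) (beq_le_left (BName.mk ι xd xv) y i)
      refine ex_elim h1 fun j => ?_
      have h2 : beq (BName.mk ι xd xv) y ⊓ beq y z ⊓ xv i ⊓ (y.val j ⊓ beq (y.dom j) (xd i)) ≤
          mem (y.dom j) z :=
        le_trans (le_inf (inf_le_left.trans (inf_le_left.trans inf_le_right))
          (inf_le_right.trans inf_le_left)) (beq_le_left y z j)
      refine ex_elim h2 fun k => ?_
      refine le_iSup_of_le k (le_inf (inf_le_right.trans inf_le_left) ?_)
      refine beq_symm' ?_
      refine le_trans (le_inf ?_ ?_) (ih i (y.dom j) (z.dom k))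
      · exact beq_symm' (inf_le_left.trans (inf_le_right.trans inf_le_right))
      · exact beq_symm' (inf_le_right.trans inf_le_right)
    have key2 : ∀ k : z.Idx,
        beq (BName.mk ι xd xv) y ⊓ beq y z ⊓ z.val k ≤ mem (z.dom k) (BName.mk ι xd xv) := by
      intro k
      have h1 : beq (BName.mk ι xd xv) y ⊓ beq y z ⊓ z.val k ≤ mem (z.dom k) y := by
        refine le_trans (inf_le_inf_right _ inf_le_right) ?_
        rw [beq_symm]
        exact beq_le_left z y k
      refine ex_elim h1 fun j => ?_
      have h2 : beq (BName.mk ι xd xv) y ⊓ beq y z ⊓ z.val k ⊓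
          (y.val j ⊓ beq (y.dom j) (z.dom k)) ≤ mem (y.dom j) (BName.mk ι xd xv) := by
        refine le_trans (le_inf (inf_le_left.trans (inf_le_left.trans inf_le_left))
          (inf_le_right.trans inf_le_left)) ?_
        rw [beq_symm]
        exact beq_le_left y _ j
      refine ex_elim h2 fun i => ?_
      refine le_iSup_of_le i (le_inf (inf_le_right.trans inf_le_left) ?_)
      refine le_trans (le_inf ?_ ?_) (ih i (y.dom j) (z.dom k))
      · exact inf_le_right.trans inf_le_right
      · exact inf_le_left.trans (inf_le_right.trans inf_le_right)
    rw [beq_unfold (BName.mk ι xd xv) z]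
    exact le_inf (le_iInf fun i => le_himp_iff.2 (key i)) (le_iInf fun k => le_himp_iff.2 (key2 k))

theorem beq_trans' {G : A} {x y z : BName A} (h1 : G ≤ beq x y) (h2 : G ≤ beq y z) :
    G ≤ beq x z := (le_inf h1 h2).trans (beq_trans x y z)

theorem mem_congr {G : A} {x x' y y' : BName A} (h : G ≤ mem x y) (hx : G ≤ beq x x')
    (hy : G ≤ beq y y') : G ≤ mem x' y' := by
  refine ex_elim h fun j => ?_
  have h2 : G ⊓ (y.val j ⊓ beq (y.dom j) x) ≤ mem (y.dom j) y' :=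
    le_trans (le_inf (inf_le_left.trans hy) (inf_le_right.trans inf_le_left)) (beq_le_left y y' j)
  refine ex_elim h2 fun k => le_iSup_of_le k (le_inf (inf_le_right.trans inf_le_left) ?_)
  refine beq_trans' (inf_le_right.trans inf_le_right) ?_
  refine beq_trans' (y := x) (inf_le_left.trans (inf_le_right.trans inf_le_right)) ?_
  exact inf_le_left.trans (inf_le_left.trans hx)

theorem ext_eq (x y : BName A) :
    (⨅ t : BName A, (mem t x ⇨ mem t y) ⊓ (mem t y ⇨ mem t x)) = beq x y := by
  apply le_antisymm
  · rw [beq_unfold]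
    refine le_inf (le_iInf fun i => ?_) (le_iInf fun i => ?_)
    · exact (iInf_le _ (x.dom i)).trans (inf_le_left.trans (himp_le_himp_right (val_le_mem x i)))
    · exact (iInf_le _ (y.dom i)).trans (inf_le_right.trans (himp_le_himp_right (val_le_mem y i)))
  · refine le_iInf fun t => le_inf (le_himp_iff.2 ?_) (le_himp_iff.2 ?_)
    · exact mem_congr inf_le_right (by simp [beq_refl]) inf_le_left
    · exact mem_congr inf_le_right (by simp [beq_refl]) (beq_symm' inf_le_left)

theorem ext_le {G : A} {x y : BName A} (h : ∀ t, G ⊓ mem t x ≤ mem t y)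
    (h' : ∀ t, G ⊓ mem t y ≤ mem t x) : G ≤ beq x y := by
  rw [← ext_eq]
  exact le_iInf fun t => le_inf (le_himp_iff.2 (h t)) (le_himp_iff.2 (h' t))

end Basic

/-! ### The formulas `x ≠ ∅` and "`f` is a function from `x` to `y`" -/

/-- The name of the empty set. -/
def emptyName (A : Type u) : BName A := BName.mk PEmpty PEmpty.elim PEmpty.elim

/-- `[[x ≠ ∅]]`. -/
def neEmpty {A : Type u} [CompleteBooleanAlgebra A] (x : BName A) : A := (beq x (emptyName A))ᶜ

/-- `[[w = {u, v}]]`, that is `[[∀ t, t ∈ w ↔ (t = u ∨ t = v)]]`. -/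
def isUPair {A : Type u} [CompleteBooleanAlgebra A] (w u v : BName A) : A :=
  ⨅ t : BName A, (mem t w ⇨ beq t u ⊔ beq t v) ⊓ (beq t u ⊔ beq t v ⇨ mem t w)

/-- `[[z = (u, v)]]` for Kuratowski pairs, that is
`[[∀ w, w ∈ z ↔ (w = {u, u} ∨ w = {u, v})]]`. -/
def isOPair {A : Type u} [CompleteBooleanAlgebra A] (z u v : BName A) : A :=
  ⨅ w : BName A, (mem w z ⇨ isUPair w u u ⊔ isUPair w u v) ⊓
    (isUPair w u u ⊔ isUPair w u v ⇨ mem w z)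

/-- `[[(u, v) ∈ f]]`, that is `[[∃ z, z = (u, v) ∧ z ∈ f]]`. -/
def pairMem {A : Type u} [CompleteBooleanAlgebra A] (u v f : BName A) : A :=
  ⨆ z : BName A, isOPair z u v ⊓ mem z f

/-- `[[f is a function from x to y]]`: the elements of `f` are pairs `(u, v)` with `u ∈ x` and
`v ∈ y`, every `u ∈ x` has an image, and images are unique. -/
def isFun {A : Type u} [CompleteBooleanAlgebra A] (x y f : BName A) : A :=
  (⨅ z : BName A, mem z f ⇨ ⨆ u : BName A, ⨆ v : BName A, mem u x ⊓ mem v y ⊓ isOPair z u v) ⊓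
    (⨅ u : BName A, mem u x ⇨ ⨆ v : BName A, pairMem u v f) ⊓
    (⨅ u : BName A, ⨅ v : BName A, ⨅ v' : BName A, pairMem u v f ⊓ pairMem u v' f ⇨ beq v v')

/-- A name for the unordered pair. -/
def upair {A : Type u} [CompleteBooleanAlgebra A] (u v : BName A) : BName A :=
  BName.mk (ULift.{u} Bool) (fun b => if b.down then u else v) (fun _ => ⊤)

/-- A name for the ordered pair. -/
def opair {A : Type u} [CompleteBooleanAlgebra A] (u v : BName A) : BName A :=
  upair (upair u u) (upair u v)

section Pairs

variable {A : Type u} [CompleteBooleanAlgebra A]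

theorem mem_upair (t u v : BName A) : mem t (upair u v) = beq t u ⊔ beq t v := by
  have : mem t (upair u v) = ⨆ b : ULift.{u} Bool, beq (if b.down then u else v) t := by
    simp [mem, upair, BName.val, BName.dom, BName.Idx]
  have h2 : (⨆ b : ULift.{u} Bool, beq (if b.down then u else v) t) =
      ⨆ b : Bool, beq (if b then u else v) t :=
    Equiv.ulift.iSup_congr (fun _ => rfl)
  rw [this, h2, iSup_bool_eq, beq_symm t u, beq_symm t v]
  rfl

theorem isUPair_eq (w u v : BName A) : isUPair w u v = beq w (upair u v) := by
  simp only [isUPair, ← mem_upair, ext_eq]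

theorem isOPair_eq (z u v : BName A) : isOPair z u v = beq z (opair u v) := by
  simp only [isOPair, isUPair_eq, ← mem_upair, ext_eq, opair]

theorem pairMem_eq (u v f : BName A) : pairMem u v f = mem (opair u v) f := by
  simp only [pairMem, isOPair_eq]
  apply le_antisymm
  · exact iSup_le fun z => mem_congr inf_le_right inf_le_left (by simp [beq_refl])
  · exact le_iSup_of_le (opair u v) (by simp [beq_refl])

theorem upair_congr {G : A} {u u' v v' : BName A} (hu : G ≤ beq u u') (hv : G ≤ beq v v') :
    G ≤ beq (upair u v) (upair u' v') := by
  refine ext_le (fun t => ?_) (fun t => ?_) <;> rw [mem_upair, mem_upair, inf_sup_left] <;>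
    refine sup_le_sup ?_ ?_
  · exact beq_trans' inf_le_right (inf_le_left.trans hu)
  · exact beq_trans' inf_le_right (inf_le_left.trans hv)
  · exact beq_trans' inf_le_right (inf_le_left.trans (beq_symm' hu))
  · exact beq_trans' inf_le_right (inf_le_left.trans (beq_symm' hv))

theorem opair_congr {G : A} {u u' v v' : BName A} (hu : G ≤ beq u u') (hv : G ≤ beq v v') :
    G ≤ beq (opair u v) (opair u' v') :=
  upair_congr (upair_congr hu hu) (upair_congr hu hv)

theorem upair_right {G : A} {u v u' v' : BName A} (h : G ≤ beq (upair u v) (upair u' v')) :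
    G ≤ beq v u' ⊔ beq v v' := by
  rw [← mem_upair]
  refine mem_congr (x := v) ?_ (by simp [beq_refl]) h
  simp [mem_upair, beq_refl]

theorem upair_left {G : A} {u v u' v' : BName A} (h : G ≤ beq (upair u v) (upair u' v')) :
    G ≤ beq u u' ⊔ beq u v' := by
  rw [← mem_upair]
  refine mem_congr (x := u) ?_ (by simp [beq_refl]) h
  simp [mem_upair, beq_refl]

theorem opair_left {G : A} {u v u' v' : BName A} (h : G ≤ beq (opair u v) (opair u' v')) :
    G ≤ beq u u' := by
  refine or_elim (upair_left h) ?_ ?_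
  · simpa using upair_left (G := G ⊓ beq (upair u u) (upair u' u')) inf_le_right
  · have := upair_left (G := G ⊓ beq (upair u u) (upair u' v'))
      (beq_symm' (inf_le_right (a := G)))
    simpa [beq_symm] using this

theorem opair_right_aux {G : A} {u v v' : BName A} (h : G ≤ beq (opair u v) (opair u v')) :
    G ≤ beq v u ⊔ beq v v' := by
  refine or_elim (upair_right h) ?_ ?_
  · refine (upair_right (G := G ⊓ beq (upair u v) (upair u u)) inf_le_right).trans ?_
    simp
  · exact upair_right inf_le_right

theorem opair_right {G : A} {u v u' v' : BName A} (h : G ≤ beq (opair u v) (opair u' v')) :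
    G ≤ beq v v' := by
  have hu := opair_left h
  have h1 : G ≤ beq (opair u v) (opair u v') :=
    beq_trans' h (opair_congr (beq_symm' hu) (by simp [beq_refl]))
  refine or_elim (opair_right_aux h1) ?_ inf_le_right
  refine or_elim (inf_le_left.trans (opair_right_aux (beq_symm' h1))) ?_ ?_
  · exact beq_trans' (inf_le_left.trans inf_le_right) (beq_symm' inf_le_right)
  · exact beq_symm' inf_le_right

theorem pairMem_congr {G : A} {u u' v v' f f' : BName A} (h : G ≤ pairMem u v f)
    (hu : G ≤ beq u u') (hv : G ≤ beq v v') (hf : G ≤ beq f f') : G ≤ pairMem u' v' f' := by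
  rw [pairMem_eq] at h ⊢
  exact mem_congr h (opair_congr hu hv) hf

/-- `f` is a name for a function from `x` to `y`. -/
def IsFunName (x y f : BName A) : Prop := isFun x y f = ⊤

theorem isFunName_iff (x y f : BName A) : IsFunName x y f ↔
    (∀ z, mem z f ≤ ⨆ u, ⨆ v, mem u x ⊓ mem v y ⊓ beq z (opair u v)) ∧
    (∀ u, mem u x ≤ ⨆ v, pairMem u v f) ∧
    (∀ u v v', pairMem u v f ⊓ pairMem u v' f ≤ beq v v') := by
  simp only [IsFunName, isFun, inf_eq_top_iff, iInf_eq_top, himp_eq_top_iff, isOPair_eq, and_assoc]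

theorem IsFunName.dom_cod {x y f : BName A} (h : IsFunName x y f) (u v : BName A) :
    pairMem u v f ≤ mem u x ⊓ mem v y := by
  have h1 := ((isFunName_iff x y f).1 h).1 (opair u v)
  rw [pairMem_eq]
  refine ex_elim h1 fun u' => ex_elim inf_le_right fun v' => ?_
  have h2 : mem (opair u v) f ⊓ (⨆ v', mem u' x ⊓ mem v' y ⊓ beq (opair u v) (opair u' v')) ⊓
      (mem u' x ⊓ mem v' y ⊓ beq (opair u v) (opair u' v')) ≤ beq (opair u v) (opair u' v') :=
    inf_le_right.trans inf_le_right
  refine le_inf ?_ ?_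
  · exact mem_congr (inf_le_right.trans (inf_le_left.trans inf_le_left))
      (beq_symm' (opair_left h2)) (by simp [beq_refl])
  · exact mem_congr (inf_le_right.trans (inf_le_left.trans inf_le_right))
      (beq_symm' (opair_right h2)) (by simp [beq_refl])

theorem IsFunName.total {x y f : BName A} (h : IsFunName x y f) (u : BName A) :
    mem u x ≤ ⨆ v, pairMem u v f := ((isFunName_iff x y f).1 h).2.1 u

theorem IsFunName.uniq {x y f : BName A} (h : IsFunName x y f) (u v v' : BName A) :
    pairMem u v f ⊓ pairMem u v' f ≤ beq v v' := ((isFunName_iff x y f).1 h).2.2 u v v'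

/-- Names for functions with `[[f ⊆ g]] = 1` on pairs are equal with truth value `1`. -/
theorem IsFunName.ext {x y f g : BName A} (hf : IsFunName x y f) (hg : IsFunName x y g)
    (h : ∀ u v, pairMem u v f ≤ pairMem u v g) : beq f g = ⊤ := by
  have h' : ∀ u v, pairMem u v g ≤ pairMem u v f := by
    intro u v
    have h1 : pairMem u v g ≤ ⨆ v, pairMem u v f :=
      (hg.dom_cod u v).trans (inf_le_left.trans (hf.total u))
    refine ex_elim h1 fun v' => ?_
    refine pairMem_congr inf_le_right (by simp [beq_refl]) ?_ (by simp [beq_refl])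
    exact le_trans (le_inf (inf_le_right.trans (h u v')) inf_le_left) (hg.uniq u v' v)
  have key : ∀ f g : BName A, IsFunName x y f → (∀ u v, pairMem u v f ≤ pairMem u v g) →
      ∀ t, ⊤ ⊓ mem t f ≤ mem t g := by
    intro f g hf h t
    rw [top_inf_eq]
    refine ex_elim (((isFunName_iff x y f).1 hf).1 t) fun u => ex_elim inf_le_right fun v => ?_
    have h3 : mem t f ⊓ (⨆ v, mem u x ⊓ mem v y ⊓ beq t (opair u v)) ⊓
        (mem u x ⊓ mem v y ⊓ beq t (opair u v)) ≤ beq t (opair u v) :=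
      inf_le_right.trans inf_le_right
    refine mem_congr (x := opair u v) (y := g) ?_ (beq_symm' h3) (by simp [beq_refl])
    rw [← pairMem_eq]
    refine le_trans ?_ (h u v)
    rw [pairMem_eq]
    exact mem_congr (inf_le_left.trans inf_le_left) h3 (by simp [beq_refl])
  exact top_le_iff.1 (ext_le (key f g hf h) (key g f hg h'))

/-- The name for the set of pairs `(u, w) ∈ x × z` with `R u w`. -/
def relName (x z : BName A) (R : BName A → BName A → A) : BName A :=
  BName.mk (x.Idx × z.Idx) (fun p => opair (x.dom p.1) (z.dom p.2))
    (fun p => x.val p.1 ⊓ z.val p.2 ⊓ R (x.dom p.1) (z.dom p.2))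

theorem pairMem_relName (x z : BName A) (R : BName A → BName A → A)
    (hR : ∀ u u' w w', beq u u' ⊓ beq w w' ⊓ R u w ≤ R u' w') (u w : BName A) :
    pairMem u w (relName x z R) = mem u x ⊓ mem w z ⊓ R u w := by
  rw [pairMem_eq]
  apply le_antisymm
  · refine iSup_le fun p => ?_
    change (x.val p.1 ⊓ z.val p.2 ⊓ R (x.dom p.1) (z.dom p.2)) ⊓
      beq (opair (x.dom p.1) (z.dom p.2)) (opair u w) ≤ _
    set G := (x.val p.1 ⊓ z.val p.2 ⊓ R (x.dom p.1) (z.dom p.2)) ⊓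
      beq (opair (x.dom p.1) (z.dom p.2)) (opair u w) with hG
    have h0 : G ≤ beq (opair (x.dom p.1) (z.dom p.2)) (opair u w) := inf_le_right
    have h1 : G ≤ x.val p.1 := inf_le_left.trans (inf_le_left.trans inf_le_left)
    have h2 : G ≤ z.val p.2 := inf_le_left.trans (inf_le_left.trans inf_le_right)
    have h3 : G ≤ R (x.dom p.1) (z.dom p.2) := inf_le_left.trans inf_le_right
    refine le_inf (le_inf ?_ ?_) ?_
    · exact mem_congr (h1.trans (val_le_mem x _)) (opair_left h0) (by simp [beq_refl])
    · exact mem_congr (h2.trans (val_le_mem z _)) (opair_right h0) (by simp [beq_refl])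
    · exact (le_inf (le_inf (opair_left h0) (opair_right h0)) h3).trans (hR _ _ _ _)
  · refine ex_elim (inf_le_left.trans inf_le_left) fun i => ?_
    refine ex_elim (inf_le_left.trans (inf_le_left.trans inf_le_right)) fun k => ?_
    refine le_iSup_of_le (i, k) ?_
    change _ ≤ (x.val i ⊓ z.val k ⊓ R (x.dom i) (z.dom k)) ⊓
      beq (opair (x.dom i) (z.dom k)) (opair u w)
    set G := mem u x ⊓ mem w z ⊓ R u w ⊓ (x.val i ⊓ beq (x.dom i) u) ⊓
      (z.val k ⊓ beq (z.dom k) w)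
    have h1 : G ≤ R u w := inf_le_left.trans (inf_le_left.trans inf_le_right)
    have h2 : G ≤ x.val i := inf_le_left.trans (inf_le_right.trans inf_le_left)
    have h3 : G ≤ beq (x.dom i) u := inf_le_left.trans (inf_le_right.trans inf_le_right)
    have h4 : G ≤ z.val k := inf_le_right.trans inf_le_left
    have h5 : G ≤ beq (z.dom k) w := inf_le_right.trans inf_le_right
    exact le_inf (le_inf (le_inf h2 h4)
      ((le_inf (le_inf (beq_symm' h3) (beq_symm' h5)) h1).trans (hR _ _ _ _))) (opair_congr h3 h5)

theorem isFunName_relName (x z : BName A) (R : BName A → BName A → A)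
    (hR : ∀ u u' w w', beq u u' ⊓ beq w w' ⊓ R u w ≤ R u' w')
    (htot : ∀ u, mem u x ≤ ⨆ w, mem w z ⊓ R u w)
    (huniq : ∀ u w w', mem u x ⊓ R u w ⊓ R u w' ≤ beq w w') : IsFunName x z (relName x z R) := by
  refine (isFunName_iff _ _ _).2 ⟨fun t => ?_, fun u => ?_, fun u w w' => ?_⟩
  · refine iSup_le fun p => ?_
    refine le_iSup_of_le (x.dom p.1) (le_iSup_of_le (z.dom p.2) ?_)
    change (x.val p.1 ⊓ z.val p.2 ⊓ R (x.dom p.1) (z.dom p.2)) ⊓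
      beq (opair (x.dom p.1) (z.dom p.2)) t ≤ _
    refine le_inf (le_inf ?_ ?_) (beq_symm' inf_le_right)
    · exact inf_le_left.trans (inf_le_left.trans (inf_le_left.trans (val_le_mem x _)))
    · exact inf_le_left.trans (inf_le_left.trans (inf_le_right.trans (val_le_mem z _)))
  · refine ex_elim (htot u) fun w => le_iSup_of_le w ?_
    rw [pairMem_relName x z R hR]
    exact le_inf (le_inf inf_le_left (inf_le_right.trans inf_le_left))
      (inf_le_right.trans inf_le_right)
  · rw [pairMem_relName x z R hR, pairMem_relName x z R hR]
    refine le_trans (le_inf (le_inf ?_ ?_) ?_) (huniq u w w')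
    · exact inf_le_left.trans (inf_le_left.trans inf_le_left)
    · exact inf_le_left.trans inf_le_right
    · exact inf_le_right.trans inf_le_right

/-- A name for the identity function on `x`. -/
def idName (x : BName A) : BName A := relName x x beq

theorem pairMem_idName (x u w : BName A) :
    pairMem u w (idName x) = mem u x ⊓ mem w x ⊓ beq u w :=
  pairMem_relName x x beq (fun _ _ _ _ =>
    beq_trans' (beq_symm' (inf_le_left.trans inf_le_left))
      (beq_trans' inf_le_right (inf_le_left.trans inf_le_right))) u w

theorem isFunName_idName (x : BName A) : IsFunName x x (idName x) := by
  refine isFunName_relName x x beq (fun _ _ _ _ =>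
    beq_trans' (beq_symm' (inf_le_left.trans inf_le_left))
      (beq_trans' inf_le_right (inf_le_left.trans inf_le_right))) (fun u => ?_) (fun u w w' => ?_)
  · exact le_iSup_of_le u (by simp [beq_refl])
  · exact beq_trans' (beq_symm' (inf_le_left.trans inf_le_right)) inf_le_right

/-- A name for the composite function `g ∘ f`, where `f` is a function from `x` to some `y` and `g`
a function from `y` to `z`. -/
def compName (x z f g : BName A) : BName A :=
  relName x z (fun u w => ⨆ v : BName A, pairMem u v f ⊓ pairMem v w g)

theorem comp_congr (f g u u' w w' : BName A) :
    beq u u' ⊓ beq w w' ⊓ (⨆ v : BName A, pairMem u v f ⊓ pairMem v w g) ≤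
      ⨆ v : BName A, pairMem u' v f ⊓ pairMem v w' g := by
  refine ex_elim inf_le_right fun v => le_iSup_of_le v (le_inf ?_ ?_)
  · exact pairMem_congr (inf_le_right.trans inf_le_left)
      (inf_le_left.trans (inf_le_left.trans inf_le_left)) (by simp [beq_refl]) (by simp [beq_refl])
  · exact pairMem_congr (inf_le_right.trans inf_le_right) (by simp [beq_refl])
      (inf_le_left.trans (inf_le_left.trans inf_le_right)) (by simp [beq_refl])

theorem isFunName_compName {x y z f g : BName A} (hf : IsFunName x y f) (hg : IsFunName y z g) :
    IsFunName x z (compName x z f g) := by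
  refine isFunName_relName x z _ (comp_congr f g) (fun u => ?_) (fun u w w' => ?_)
  · refine ex_elim (hf.total u) fun v => ?_
    have h1 : mem u x ⊓ pairMem u v f ≤ ⨆ w, pairMem v w g :=
      inf_le_right.trans ((hf.dom_cod u v).trans (inf_le_right.trans (hg.total v)))
    refine ex_elim h1 fun w => le_iSup_of_le w (le_inf ?_ (le_iSup_of_le v (le_inf ?_ ?_)))
    · exact inf_le_right.trans ((hg.dom_cod v w).trans inf_le_right)
    · exact inf_le_left.trans inf_le_right
    · exact inf_le_right
  · refine ex_elim (inf_le_left.trans inf_le_right) fun v => ?_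
    refine ex_elim (inf_le_left.trans inf_le_right) fun v' => ?_
    have hv := le_trans (le_inf (inf_le_left.trans (inf_le_right.trans inf_le_left))
      (inf_le_right.trans inf_le_left)) (hf.uniq u v v')
      (a := mem u x ⊓ (⨆ v, pairMem u v f ⊓ pairMem v w g) ⊓
        (⨆ v, pairMem u v f ⊓ pairMem v w' g) ⊓ (pairMem u v f ⊓ pairMem v w g) ⊓
        (pairMem u v' f ⊓ pairMem v' w' g))
    refine le_trans (le_inf ?_ (inf_le_right.trans inf_le_right)) (hg.uniq v' w w')
    exact pairMem_congr (inf_le_left.trans (inf_le_right.trans inf_le_right)) hv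
      (by simp [beq_refl]) (by simp [beq_refl])

theorem pairMem_compName {x y z f g : BName A} (hf : IsFunName x y f) (hg : IsFunName y z g)
    (u w : BName A) :
    pairMem u w (compName x z f g) = ⨆ v : BName A, pairMem u v f ⊓ pairMem v w g := by
  rw [compName, pairMem_relName x z _ (comp_congr f g)]
  refine le_antisymm inf_le_right (le_inf (iSup_le fun v => le_inf ?_ ?_) le_rfl)
  · exact inf_le_left.trans ((hf.dom_cod u v).trans inf_le_left)
  · exact inf_le_right.trans ((hg.dom_cod v w).trans inf_le_right)

end Pairs

/-! ### The category of names for non-empty sets and names for functions -/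

/-- The elements `x` of `V^(A)` with `[[x ≠ ∅]] = 1`. -/
structure NameCat (A : Type u) [CompleteBooleanAlgebra A] : Type (u + 1) where
  name : BName A
  ne_empty : neEmpty name = ⊤

section NameCategory

variable {A : Type u} [CompleteBooleanAlgebra A]

/-- Equivalence of names for functions: `f ∼ g` when `[[f = g]] = 1`. -/
def funSetoid (x y : BName A) : Setoid {f : BName A // IsFunName x y f} where
  r f g := beq f.1 g.1 = ⊤
  iseqv :=
    ⟨fun f => beq_refl f.1, fun {f g} h => by rw [beq_symm, h],
      fun {f g h} h1 h2 => top_le_iff.1 (beq_trans' h1.ge h2.ge)⟩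

/-- Morphisms are names for functions, two names being the same morphism when `[[f = g]] = 1`. -/
def NameHom (x y : NameCat A) : Type (u + 1) := Quotient (funSetoid x.name y.name)

/-- The morphism given by a name for a function. -/
def NameHom.mk {x y : NameCat A} (f : BName A) (hf : IsFunName x.name y.name f) : NameHom x y :=
  Quotient.mk (funSetoid x.name y.name) ⟨f, hf⟩

theorem NameHom.mk_eq {x y : NameCat A} {f g : BName A} {hf : IsFunName x.name y.name f}
    {hg : IsFunName x.name y.name g} (h : ∀ u v, pairMem u v f ≤ pairMem u v g) :
    NameHom.mk (x := x) (y := y) f hf = NameHom.mk g hg :=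
  Quotient.sound (s := funSetoid x.name y.name) (hf.ext hg h)

theorem pairMem_le_of_beq {f g : BName A} (h : beq f g = ⊤) (u v : BName A) :
    pairMem u v f ≤ pairMem u v g :=
  pairMem_congr le_rfl (by simp [beq_refl]) (by simp [beq_refl]) (by simp [h])

/-- Composition of morphisms is composition of functions in `V^(A)`. -/
def NameHom.comp {x y z : NameCat A} (f : NameHom x y) (g : NameHom y z) : NameHom x z :=
  Quotient.map₂ (sa := funSetoid x.name y.name) (sb := funSetoid y.name z.name)
    (sc := funSetoid x.name z.name)
    (fun f g => ⟨compName x.name z.name f.1 g.1, isFunName_compName f.2 g.2⟩)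
    (by
      intro f f' hf g g' hg
      refine IsFunName.ext (isFunName_compName f.2 g.2) (isFunName_compName f'.2 g'.2)
        fun u w => ?_
      rw [pairMem_compName f.2 g.2, pairMem_compName f'.2 g'.2]
      exact iSup_mono fun v => inf_le_inf (pairMem_le_of_beq hf u v) (pairMem_le_of_beq hg v w))
    f g

instance : Category.{u + 1, u + 1} (NameCat A) where
  Hom x y := NameHom x y
  id x := NameHom.mk (idName x.name) (isFunName_idName x.name)
  comp f g := NameHom.comp f g
  id_comp {x y} f := by
    induction f using Quotient.inductionOn with
    | h f =>
      refine NameHom.mk_eq fun u w => ?_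
      rw [pairMem_compName (isFunName_idName x.name) f.2]
      refine iSup_le fun v => ?_
      rw [pairMem_idName]
      exact pairMem_congr inf_le_right (beq_symm' (inf_le_left.trans inf_le_right))
        (by simp [beq_refl]) (by simp [beq_refl])
  comp_id {x y} f := by
    induction f using Quotient.inductionOn with
    | h f =>
      refine NameHom.mk_eq fun u w => ?_
      rw [pairMem_compName f.2 (isFunName_idName y.name)]
      refine iSup_le fun v => ?_
      rw [pairMem_idName]
      exact pairMem_congr inf_le_left (by simp [beq_refl]) (inf_le_right.trans inf_le_right)
        (by simp [beq_refl])
  assoc {w x y z} f g h := by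
    induction f using Quotient.inductionOn with
    | h f =>
    induction g using Quotient.inductionOn with
    | h g =>
    induction h using Quotient.inductionOn with
    | h h =>
      refine NameHom.mk_eq fun a d => ?_
      rw [pairMem_compName (isFunName_compName f.2 g.2) h.2,
        pairMem_compName f.2 (isFunName_compName g.2 h.2)]
      refine iSup_le fun c => ?_
      rw [pairMem_compName f.2 g.2, iSup_inf_eq]
      refine iSup_le fun b => le_iSup_of_le b ?_
      rw [pairMem_compName g.2 h.2]
      exact le_inf (inf_le_left.trans inf_le_left)
        (le_iSup_of_le c (inf_le_inf_right _ inf_le_right))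

end NameCategory

/-! ### Conditional sets and conditional functions -/

/-- The family `a` is a partition of `b` (members may be `0`, the index set is arbitrary). -/
def IsPartition {A : Type u} [CompleteBooleanAlgebra A] {I : Type u} (a : I → A) (b : A) : Prop :=
  (⨆ i, a i) = b ∧ ∀ i j, i ≠ j → a i ⊓ a j = ⊥

/-- A conditional set over `A`: a non-empty set `X` (`carrier`), a set `𝐗` (`cond`) and a surjection
`(x, a) ↦ x|a` (`restr`) from `X × A` onto `𝐗` satisfying: `x|a = y|b` implies `a = b`,
consistency and stability. -/
structure CondSet (A : Type u) [CompleteBooleanAlgebra A] : Type (u + 1) where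
  carrier : Type u
  nonempty : Nonempty carrier
  cond : Type u
  restr : carrier → A → cond
  surj : ∀ z : cond, ∃ (x : carrier) (a : A), restr x a = z
  snd_eq : ∀ (x y : carrier) (a b : A), restr x a = restr y b → a = b
  consistency : ∀ (x y : carrier) (a b : A), a ≤ b → restr x b = restr y b → restr x a = restr y a
  stability : ∀ (I : Type u) (a : I → A) (x : I → carrier), IsPartition a ⊤ →
    ∃! z : carrier, ∀ i, restr z (a i) = restr (x i) (a i)

section CondSets

variable {A : Type u} [CompleteBooleanAlgebra A]

/-- The concatenation `∑ x_i|a_i`. -/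
noncomputable def CondSet.concat (X : CondSet A) {I : Type u} (a : I → A) (ha : IsPartition a ⊤)
    (x : I → X.carrier) : X.carrier := (X.stability I a x ha).choose

theorem CondSet.concat_spec (X : CondSet A) {I : Type u} (a : I → A) (ha : IsPartition a ⊤)
    (x : I → X.carrier) (i : I) : X.restr (X.concat a ha x) (a i) = X.restr (x i) (a i) :=
  (X.stability I a x ha).choose_spec.1 i

theorem CondSet.eq_concat (X : CondSet A) {I : Type u} (a : I → A) (ha : IsPartition a ⊤)
    (x : I → X.carrier) (z : X.carrier) (h : ∀ i, X.restr z (a i) = X.restr (x i) (a i)) :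
    z = X.concat a ha x :=
  (X.stability I a x ha).choose_spec.2 z h

/-- A function `f : X → Y` between the underlying sets is stable if it preserves concatenations. -/
def IsStable (X Y : CondSet A) (f : X.carrier → Y.carrier) : Prop :=
  ∀ (I : Type u) (a : I → A) (ha : IsPartition a ⊤) (x : I → X.carrier),
    f (X.concat a ha x) = Y.concat a ha (fun i => f (x i))

/-- A conditional function `𝐗 → 𝐘`, given by its stable function `X → Y`. -/
structure CondFun (X Y : CondSet A) : Type u where
  toFun : X.carrier → Y.carrier
  stable : IsStable X Y toFun

theorem CondFun.ext' {X Y : CondSet A} {f g : CondFun X Y} (h : ∀ x, f.toFun x = g.toFun x) :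
    f = g := by
  cases f; cases g; congr; exact funext h

/-- The conditional graph `{(x|a, f(x)|a)}` of a conditional function. -/
def CondFun.condGraph {X Y : CondSet A} (f : CondFun X Y) : Set (X.cond × Y.cond) :=
  {p | ∃ (x : X.carrier) (a : A), p = (X.restr x a, Y.restr (f.toFun x) a)}

theorem isPartition_unit : IsPartition (fun _ : PUnit.{u + 1} => (⊤ : A)) ⊤ :=
  ⟨by simp, fun i j h => (h (Subsingleton.elim i j)).elim⟩

theorem CondSet.eq_of_restr_top (X : CondSet A) {x y : X.carrier}
    (h : X.restr x ⊤ = X.restr y ⊤) : x = y := by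
  obtain ⟨z, -, hz⟩ := X.stability PUnit.{u + 1} (fun _ => ⊤) (fun _ => y) isPartition_unit
  exact (hz x fun _ => h).trans (hz y fun _ => rfl).symm

/-- A conditional function is determined by its conditional graph. -/
theorem CondFun.condGraph_injective {X Y : CondSet A} :
    Function.Injective (CondFun.condGraph (X := X) (Y := Y)) := by
  intro f g h
  refine CondFun.ext' fun x => ?_
  have hx : (X.restr x ⊤, Y.restr (f.toFun x) ⊤) ∈ f.condGraph := ⟨x, ⊤, rfl⟩
  rw [h] at hx
  obtain ⟨x', a, he⟩ := hx
  rw [Prod.mk.injEq] at he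
  obtain rfl := X.snd_eq _ _ _ _ he.1
  obtain rfl := X.eq_of_restr_top he.1
  exact Y.eq_of_restr_top he.2

instance : Category.{u, u + 1} (CondSet A) where
  Hom X Y := CondFun X Y
  id X := ⟨id, fun _ _ _ _ => rfl⟩
  comp f g := ⟨g.toFun ∘ f.toFun, fun I a ha x => by
    simp only [Function.comp_apply, f.stable I a ha x, g.stable I a ha]⟩

/-- Partitions subordinate to a family with supremum `1`. -/
theorem exists_partition {I : Type u} (b : I → A) (hb : (⨆ i, b i) = ⊤) :
    ∃ a : I → A, (∀ i, a i ≤ b i) ∧ IsPartition a ⊤ := by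
  classical
  let r : I → I → Prop := WellOrderingRel
  have hwf : WellFounded r := IsWellFounded.wf
  let a : I → A := fun i => b i \ ⨆ j, ⨆ _ : r j i, b j
  have hdis : ∀ i j, r i j → a i ⊓ a j = ⊥ := by
    intro i j hij
    refine le_bot_iff.1 ?_
    have h1 : a i ≤ ⨆ k, ⨆ _ : r k j, b k := sdiff_le.trans (le_iSup₂_of_le i hij le_rfl)
    exact (inf_le_inf_right _ h1).trans (by simp [a])
  refine ⟨a, fun i => sdiff_le, top_le_iff.1 ?_, fun i j hij => ?_⟩
  · rw [← hb]
    refine iSup_le fun i => ?_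
    induction i using hwf.induction with
    | h i ih =>
      have h1 : b i ≤ a i ⊔ ⨆ j, ⨆ _ : r j i, b j := by simp [a]
      exact h1.trans (sup_le (le_iSup a i) (iSup₂_le ih))
  · rcases trichotomous_of r i j with h | h | h
    · exact hdis i j h
    · exact absurd h hij
    · rw [inf_comm]; exact hdis j i h

/-- The mixing of names along a family of elements of `A`. -/
def mix {I : Type u} (a : I → A) (x : I → BName A) : BName A :=
  BName.mk (Σ i, (x i).Idx) (fun p => (x p.1).dom p.2) (fun p => a p.1 ⊓ (x p.1).val p.2)

theorem mix_spec {I : Type u} (a : I → A) (ha : ∀ i j, i ≠ j → a i ⊓ a j = ⊥) (x : I → BName A)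
    (i : I) : a i ≤ beq (mix a x) (x i) := by
  refine ext_le (fun t => ?_) (fun t => ?_)
  · refine ex_elim inf_le_right fun p => ?_
    obtain ⟨j, k⟩ := p
    change a i ⊓ mem t (mix a x) ⊓ (a j ⊓ (x j).val k ⊓ beq ((x j).dom k) t) ≤ _
    by_cases h : i = j
    · subst h
      exact le_iSup_of_le k (inf_le_right.trans (inf_le_inf_right _ inf_le_right))
    · refine le_trans (le_inf (inf_le_left.trans inf_le_left)
        (inf_le_right.trans (inf_le_left.trans inf_le_left))) ((ha i j h).le.trans bot_le)
  · refine ex_elim inf_le_right fun k => ?_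
    refine le_iSup_of_le (⟨i, k⟩ : Σ i, (x i).Idx) ?_
    change _ ≤ a i ⊓ (x i).val k ⊓ beq ((x i).dom k) t
    exact le_inf (le_inf (inf_le_left.trans inf_le_left) (inf_le_right.trans inf_le_left))
      (inf_le_right.trans inf_le_right)

theorem eq_top_of_partition {I : Type u} {a : I → A} (ha : IsPartition a ⊤) {c : A}
    (h : ∀ i, a i ≤ c) : c = ⊤ := top_le_iff.1 (ha.1 ▸ iSup_le h)

/-! ### The descent of a name -/

/-- `∼` on the names `y` with `[[y ∈ x]] = 1`. -/
def descSetoid (x : BName A) : Setoid {y : BName A // mem y x = ⊤} where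
  r y z := beq y.1 z.1 = ⊤
  iseqv :=
    ⟨fun f => beq_refl f.1, fun {f g} h => by rw [beq_symm, h],
      fun {f g h} h1 h2 => top_le_iff.1 (beq_trans' h1.ge h2.ge)⟩

/-- The classes modulo `∼` of the names `y` with `[[y ∈ x]] = 1` form a set. -/
instance descSmall (x : BName A) : Small.{u} (Quotient (descSetoid x)) := by
  let F : Quotient (descSetoid x) → x.Idx → A := fun q i => x.val i ⊓ beq (x.dom i) q.out.1
  refine small_of_injective (f := F) fun q q' h => ?_
  have h1 : beq q.out.1 q'.out.1 = ⊤ := by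
    refine top_le_iff.1 (q.out.2.ge.trans (iSup_le fun i => ?_))
    have h2 : x.val i ⊓ beq (x.dom i) q.out.1 = x.val i ⊓ beq (x.dom i) q'.out.1 := congrFun h i
    exact beq_trans' (beq_symm' inf_le_right) (h2.le.trans inf_le_right)
  rw [← Quotient.out_eq q, ← Quotient.out_eq q']
  exact Quotient.sound (s := descSetoid x) h1

/-- The descent `x↓`: the set of names `y` with `[[y ∈ x]] = 1`, one for each class modulo `∼`.
The chosen representative of `u : Desc x` in the separated universe is `u.rep`. -/
def Desc (x : BName A) : Type u := Shrink.{u} (Quotient (descSetoid x))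

/-- The representative of a point of the descent. -/
noncomputable def Desc.rep {x : BName A} (u : Desc x) : BName A :=
  ((equivShrink (Quotient (descSetoid x))).symm u).out.1

theorem Desc.rep_mem {x : BName A} (u : Desc x) : mem u.rep x = ⊤ :=
  ((equivShrink (Quotient (descSetoid x))).symm u).out.2

theorem Desc.ext {x : BName A} {u v : Desc x} (h : beq u.rep v.rep = ⊤) : u = v := by
  apply (equivShrink (Quotient (descSetoid x))).symm.injective
  rw [← Quotient.out_eq ((equivShrink (Quotient (descSetoid x))).symm u),
    ← Quotient.out_eq ((equivShrink (Quotient (descSetoid x))).symm v)]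
  exact Quotient.sound (s := descSetoid x) h

/-- The point of the descent determined by a name `y` with `[[y ∈ x]] = 1`. -/
noncomputable def Desc.mk {x : BName A} (y : BName A) (h : mem y x = ⊤) : Desc x :=
  equivShrink (Quotient (descSetoid x)) (Quotient.mk (descSetoid x) ⟨y, h⟩)

theorem Desc.rep_mk {x : BName A} (y : BName A) (h : mem y x = ⊤) :
    beq (Desc.mk y h).rep y = ⊤ := by
  have : (equivShrink (Quotient (descSetoid x))).symm (Desc.mk y h) =
      Quotient.mk (descSetoid x) ⟨y, h⟩ := by simp [Desc.mk]
  rw [Desc.rep, this]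
  exact Quotient.exact (s := descSetoid x) (Quotient.out_eq (Quotient.mk (descSetoid x) ⟨y, h⟩))

theorem exists_mem_of_iSup {x : BName A} {I : Type u} (y : I → BName A) (c : I → A)
    (hc : (⨆ i, c i) = ⊤) (hy : ∀ i, c i ≤ mem (y i) x) :
    ∃ (a : I → A) (m : BName A), IsPartition a ⊤ ∧ (∀ i, a i ≤ c i) ∧
      (∀ i, a i ≤ beq m (y i)) ∧ mem m x = ⊤ := by
  obtain ⟨a, hac, ha⟩ := exists_partition c hc
  refine ⟨a, mix a y, ha, hac, mix_spec a ha.2 y, eq_top_of_partition ha fun i => ?_⟩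
  exact mem_congr ((hac i).trans (hy i)) (beq_symm' (mix_spec a ha.2 y i)) (by simp [beq_refl])

theorem desc_nonempty {x : BName A} (hx : neEmpty x = ⊤) : Nonempty (Desc x) := by
  have h1 : (⨆ i, x.val i) = ⊤ := by
    have h2 : beq x (emptyName A) = ⊥ := by simpa [neEmpty] using hx
    rw [← compl_eq_bot, compl_iSup, ← h2, beq_unfold]
    have h3 : (⨅ j : (emptyName A).Idx, (emptyName A).val j ⇨ mem ((emptyName A).dom j) x) = ⊤ :=
      iInf_eq_top.2 fun j => PEmpty.elim j
    have h4 : ∀ t : BName A, mem t (emptyName A) = ⊥ := fun t =>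
      iSup_eq_bot.2 fun j => PEmpty.elim j
    simp [h3, h4]
  obtain ⟨a, m, -, -, -, hm⟩ := exists_mem_of_iSup x.dom x.val h1 (val_le_mem x)
  exact ⟨Desc.mk m hm⟩

/-- The relation `(u, a) ∼ (v, b)`, i.e. `a = b` and `[[u = v]] ≥ a`, on `x↓ × A`. -/
def condSetoid (x : BName A) : Setoid (Desc x × A) where
  r p q := p.2 = q.2 ∧ p.2 ≤ beq p.1.rep q.1.rep
  iseqv :=
    ⟨fun p => ⟨rfl, by simp [beq_refl]⟩, fun {p q} h => ⟨h.1.symm, h.1 ▸ beq_symm' h.2⟩,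
      fun {p q r} h1 h2 => ⟨h1.1.trans h2.1, beq_trans' h1.2 (h1.1 ▸ h2.2)⟩⟩

theorem condSetoid_iff {x : BName A} {u v : Desc x} {a b : A} :
    Quotient.mk (condSetoid x) (u, a) = Quotient.mk (condSetoid x) (v, b) ↔
      a = b ∧ a ≤ beq u.rep v.rep :=
  ⟨fun h => Quotient.exact (s := condSetoid x) h, fun h => Quotient.sound (s := condSetoid x) h⟩

/-- The conditional set `𝐱↓` obtained as the quotient of `x↓ × A`; `u|a` is the class of `(u, a)`. -/
def descent (x : NameCat A) : CondSet A where
  carrier := Desc x.name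
  nonempty := desc_nonempty x.ne_empty
  cond := Quotient (condSetoid x.name)
  restr u a := Quotient.mk (condSetoid x.name) (u, a)
  surj z := by
    induction z using Quotient.inductionOn with
    | h p => exact ⟨p.1, p.2, rfl⟩
  snd_eq u v a b h := (condSetoid_iff.1 h).1
  consistency u v a b hab h := condSetoid_iff.2 ⟨rfl, hab.trans (condSetoid_iff.1 h).2⟩
  stability I a u ha := by
    have hm : mem (mix a fun i => (u i).rep) x.name = ⊤ := eq_top_of_partition ha fun i =>
      mem_congr (x := (u i).rep) (y := x.name) (le_top.trans (u i).rep_mem.ge)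
        (beq_symm' (mix_spec a ha.2 _ i)) (by simp [beq_refl])
    refine ⟨Desc.mk _ hm, fun i => condSetoid_iff.2 ⟨rfl, ?_⟩, fun v hv => Desc.ext ?_⟩
    · exact beq_trans' (le_top.trans (Desc.rep_mk _ hm).ge) (mix_spec a ha.2 _ i)
    · refine eq_top_of_partition ha fun i => ?_
      refine beq_trans' (condSetoid_iff.1 (hv i)).2 (beq_symm' ?_)
      exact beq_trans' (le_top.trans (Desc.rep_mk _ hm).ge) (mix_spec a ha.2 _ i)

theorem exists_value {x y f : BName A} (hf : IsFunName x y f) (u : Desc x) :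
    ∃ v : Desc y, pairMem u.rep v.rep f = ⊤ := by
  have h1 : (⨆ j, y.val j ⊓ pairMem u.rep (y.dom j) f) = ⊤ := by
    refine top_le_iff.1 (u.rep_mem.ge.trans (ex_elim (hf.total u.rep) fun v => ?_))
    have h2 : mem u.rep x ⊓ pairMem u.rep v f ≤ mem v y :=
      inf_le_right.trans ((hf.dom_cod _ _).trans inf_le_right)
    refine ex_elim h2 fun j => le_iSup_of_le j (le_inf (inf_le_right.trans inf_le_left) ?_)
    exact pairMem_congr (inf_le_left.trans inf_le_right) (by simp [beq_refl])
      (beq_symm' (inf_le_right.trans inf_le_right)) (by simp [beq_refl])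
  obtain ⟨a, m, ha, hac, ham, hm⟩ := exists_mem_of_iSup (x := y) y.dom _ h1
    fun j => inf_le_left.trans (val_le_mem y j)
  refine ⟨Desc.mk m hm, eq_top_of_partition ha fun i => ?_⟩
  refine pairMem_congr ((hac i).trans inf_le_right) (by simp [beq_refl]) ?_ (by simp [beq_refl])
  exact beq_trans' (beq_symm' (ham i)) (beq_symm' (le_top.trans (Desc.rep_mk m hm).ge))

/-- The function `f↓ : x↓ → y↓`, with `[[f↓(u) = f(u)]] = 1`, that is `[[(u, f↓(u)) ∈ f]] = 1`. -/
noncomputable def descFun {x y f : BName A} (hf : IsFunName x y f) (u : Desc x) : Desc y :=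
  (exists_value hf u).choose

theorem descFun_spec {x y f : BName A} (hf : IsFunName x y f) (u : Desc x) :
    pairMem u.rep (descFun hf u).rep f = ⊤ := (exists_value hf u).choose_spec

theorem descFun_unique {x y f : BName A} (hf : IsFunName x y f) {u : Desc x} {v : Desc y}
    (h : pairMem u.rep v.rep f = ⊤) : descFun hf u = v :=
  Desc.ext (top_le_iff.1 ((le_inf (descFun_spec hf u).ge h.ge).trans (hf.uniq _ _ _)))

theorem descFun_mono {x y f : BName A} (hf : IsFunName x y f) (u v : Desc x) :
    beq u.rep v.rep ≤ beq (descFun hf u).rep (descFun hf v).rep := by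
  refine le_trans (le_inf ?_ ?_) (hf.uniq v.rep _ _)
  · exact pairMem_congr (le_top.trans (descFun_spec hf u).ge) le_rfl
      (le_top.trans (beq_refl _).ge) (le_top.trans (beq_refl _).ge)
  · exact le_top.trans (descFun_spec hf v).ge

theorem descFun_stable {x y : NameCat A} {f : BName A} (hf : IsFunName x.name y.name f) :
    IsStable (descent x) (descent y) (descFun hf) := by
  intro I a ha u
  refine CondSet.eq_concat (descent y) a ha _ _ fun i => condSetoid_iff.2 ⟨rfl, ?_⟩
  exact (condSetoid_iff.1 ((descent x).concat_spec a ha u i)).2.trans (descFun_mono hf _ _)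

/-- The action of descent on morphisms: `[f] ↦ 𝐟↓`. -/
noncomputable def descentMap {x y : NameCat A} (f : NameHom x y) :
    CondFun (descent x) (descent y) :=
  Quotient.lift (s := funSetoid x.name y.name)
    (fun f => (⟨descFun f.2, descFun_stable f.2⟩ : CondFun (descent x) (descent y)))
    (fun f g h => CondFun.ext' fun u => descFun_unique f.2
      (top_le_iff.1 ((descFun_spec g.2 u).ge.trans
        (pairMem_le_of_beq (by rw [beq_symm]; exact h) _ _)))) f

/-- The functor `G` with `G(x) = 𝐱↓` and `G(f) = 𝐟↓`. -/
noncomputable def descentFunctor (A : Type u) [CompleteBooleanAlgebra A] :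
    NameCat A ⥤ CondSet A where
  obj x := descent x
  map f := descentMap f
  map_id x := CondFun.ext' fun u => by
    refine descFun_unique (isFunName_idName x.name) ?_
    change pairMem u.rep u.rep _ = ⊤
    rw [pairMem_idName]
    simp [Desc.rep_mem (x := x.name) u, beq_refl]
  map_comp {x y z} f g := by
    induction f using Quotient.inductionOn with
    | h f =>
    induction g using Quotient.inductionOn with
    | h g =>
      refine CondFun.ext' fun u => ?_
      refine descFun_unique (isFunName_compName f.2 g.2) ?_
      rw [pairMem_compName f.2 g.2]
      refine top_le_iff.1 (le_iSup_of_le (descFun f.2 u).rep (le_inf ?_ ?_))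
      · exact (descFun_spec f.2 u).ge
      · exact (descFun_spec g.2 (descFun f.2 u)).ge

/-! ### The name associated with a conditional set -/

/-- The canonical name of (a presentation of) a set: all members get the value `1`. -/
def checkPSet (A : Type u) [CompleteBooleanAlgebra A] : PSet.{u} → BName A
  | PSet.mk ι f => BName.mk ι (fun i => checkPSet A (f i)) (fun _ => ⊤)

/-- The canonical name `x̌` of a set `x`. -/
noncomputable def check (A : Type u) [CompleteBooleanAlgebra A] (x : ZFSet.{u}) : BName A :=
  checkPSet A (Quotient.out x)

theorem beq_checkPSet (x y : PSet.{u}) :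
    (PSet.Equiv x y → beq (checkPSet A x) (checkPSet A y) = ⊤) ∧
      (¬ PSet.Equiv x y → beq (checkPSet A x) (checkPSet A y) = ⊥) := by
  induction x generalizing y with
  | mk ι f ih =>
    cases y with
    | mk κ g =>
      constructor
      · rintro ⟨h1, h2⟩
        simp only [checkPSet, beq, top_himp, top_inf_eq, inf_eq_top_iff, iInf_eq_top]
        refine ⟨fun i => ?_, fun j => ?_⟩
        · obtain ⟨j, hj⟩ := h1 i
          exact top_le_iff.1 (le_iSup_of_le j ((ih i (g j)).1 hj).ge)
        · obtain ⟨i, hi⟩ := h2 j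
          exact top_le_iff.1 (le_iSup_of_le i ((ih i (g j)).1 hi).ge)
      · intro h
        rw [← le_bot_iff]
        simp only [checkPSet, beq, top_himp, top_inf_eq]
        have h' : (∃ i, ∀ j, ¬ PSet.Equiv (f i) (g j)) ∨ ∃ j, ∀ i, ¬ PSet.Equiv (f i) (g j) := by
          by_contra hc
          push Not at hc
          exact h ⟨hc.1, hc.2⟩
        rcases h' with ⟨i, hi⟩ | ⟨j, hj⟩
        · exact inf_le_left.trans ((iInf_le _ i).trans (iSup_le fun j => ((ih i (g j)).2 (hi j)).le))
        · exact inf_le_right.trans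
            ((iInf_le _ j).trans (iSup_le fun i => ((ih i (g j)).2 (hj i)).le))

theorem beq_check_ne {x y : ZFSet.{u}} (h : x ≠ y) : beq (check A x) (check A y) = ⊥ := by
  refine (beq_checkPSet _ _).2 fun he => h ?_
  rw [← Quotient.out_eq x, ← Quotient.out_eq y]
  exact Quotient.sound he

/-- A way to regard the elements of the underlying set of every conditional set as sets of the
universe `V`, so that they have canonical names. -/
def Coding (A : Type u) [CompleteBooleanAlgebra A] : Type (u + 1) :=
  ∀ X : CondSet A, X.carrier ↪ ZFSet.{u}

theorem coding_nonempty (A : Type u) [CompleteBooleanAlgebra A] : Nonempty (Coding A) :=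
  ⟨fun X => ⟨fun x => (embeddingToCardinal x : Cardinal.{u}).ord.toZFSet, fun x y h => by
    have h1 := Ordinal.toZFSet_injective h
    exact embeddingToCardinal.injective (Cardinal.ord_injective h1)⟩⟩

/-- `a_{u,v} = ⨆ {b : u|b = v|b}`. -/
def agree (X : CondSet A) (u v : X.carrier) : A := sSup {b : A | X.restr u b = X.restr v b}

/-- The name `ū` with domain `{v̌ : v ∈ X}` and `ū(v̌) = a_{u,v}`. -/
noncomputable def pointName (k : Coding A) (X : CondSet A) (u : X.carrier) : BName A :=
  BName.mk X.carrier (fun v => check A (k X v)) (fun v => agree X u v)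

/-- The name `X̃` with domain `{ū : u ∈ X}` and constant value `1`. -/
noncomputable def tildeName (k : Coding A) (X : CondSet A) : BName A :=
  BName.mk X.carrier (fun u => pointName k X u) (fun _ => ⊤)

/-- The name `f̃` with domain the pairs `(ū, f(u)‾)`, `u ∈ X`, and constant value `1`. -/
noncomputable def tildeFun (k : Coding A) {X Y : CondSet A} (f : CondFun X Y) : BName A :=
  BName.mk X.carrier (fun u => opair (pointName k X u) (pointName k Y (f.toFun u))) (fun _ => ⊤)

theorem agree_self (X : CondSet A) (u : X.carrier) : agree X u u = ⊤ :=
  top_le_iff.1 (le_sSup rfl)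

theorem agree_trans (X : CondSet A) (u v t : X.carrier) :
    agree X u v ⊓ agree X u t ≤ agree X v t := by
  simp only [agree, sSup_inf_sSup]
  refine iSup₂_le fun p hp => le_sSup ?_
  have h1 := X.consistency u v (p.1 ⊓ p.2) p.1 inf_le_left hp.1
  have h2 := X.consistency u t (p.1 ⊓ p.2) p.2 inf_le_right hp.2
  exact h1.symm.trans h2

theorem agree_comm (X : CondSet A) (u v : X.carrier) : agree X u v = agree X v u := by
  simp only [agree, eq_comm]

theorem mem_check_pointName (k : Coding A) (X : CondSet A) (u t : X.carrier) :
    mem (check A (k X t)) (pointName k X u) = agree X u t := by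
  apply le_antisymm
  · refine iSup_le fun w => ?_
    change agree X u w ⊓ beq (check A (k X w)) (check A (k X t)) ≤ _
    by_cases h : w = t
    · subst h; exact inf_le_left
    · rw [beq_check_ne (fun h' => h ((k X).injective h'))]
      simp
  · exact le_iSup_of_le t (le_inf le_rfl (by simp [pointName, BName.dom, beq_refl]))

theorem beq_pointName (k : Coding A) (X : CondSet A) (u v : X.carrier) :
    beq (pointName k X u) (pointName k X v) = agree X u v := by
  rw [beq_unfold]
  change (⨅ t : X.carrier, agree X u t ⇨ mem (check A (k X t)) (pointName k X v)) ⊓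
    (⨅ t : X.carrier, agree X v t ⇨ mem (check A (k X t)) (pointName k X u)) = _
  simp only [mem_check_pointName]
  apply le_antisymm
  · refine inf_le_left.trans ((iInf_le _ u).trans ?_)
    rw [agree_self, top_himp, agree_comm]
  · refine le_inf (le_iInf fun t => le_himp_iff.2 (agree_trans X u v t))
      (le_iInf fun t => le_himp_iff.2 ?_)
    rw [agree_comm X u v]
    exact agree_trans X v u t

theorem CondFun.agree_le {X Y : CondSet A} (f : CondFun X Y) (u v : X.carrier) :
    agree X u v ≤ agree Y (f.toFun u) (f.toFun v) := by
  refine sSup_le fun b hb => le_sSup ?_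
  let a : ULift.{u} Bool → A := fun i => if i.down then b else bᶜ
  let w : ULift.{u} Bool → X.carrier := fun i => if i.down then v else u
  have ha : IsPartition a ⊤ := by
    constructor
    · have : (⨆ i, a i) = ⨆ i : Bool, if i then b else bᶜ := Equiv.ulift.iSup_congr (fun _ => rfl)
      rw [this, iSup_bool_eq]
      simp
    · rintro ⟨i⟩ ⟨j⟩ hij
      cases i <;> cases j <;> simp_all [a]
  have h1 : u = X.concat a ha w := by
    refine X.eq_concat a ha w u ?_
    rintro ⟨i⟩
    cases i
    · rfl
    · exact hb
  have h2 := Y.concat_spec a ha (fun i => f.toFun (w i)) ⟨true⟩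
  rw [← f.stable, ← h1] at h2
  exact h2

theorem mem_tildeName (k : Coding A) (X : CondSet A) (t : BName A) :
    mem t (tildeName k X) = ⨆ u : X.carrier, beq (pointName k X u) t := by
  change (⨆ u : X.carrier, ⊤ ⊓ beq (pointName k X u) t) = _
  simp

theorem pairMem_tildeFun (k : Coding A) {X Y : CondSet A} (f : CondFun X Y) (p q : BName A) :
    pairMem p q (tildeFun k f) =
      ⨆ u : X.carrier, beq (pointName k X u) p ⊓ beq (pointName k Y (f.toFun u)) q := by
  rw [pairMem_eq]
  change (⨆ u : X.carrier, ⊤ ⊓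
    beq (opair (pointName k X u) (pointName k Y (f.toFun u))) (opair p q)) = _
  refine iSup_congr fun u => ?_
  rw [top_inf_eq]
  exact le_antisymm (le_inf (opair_left le_rfl) (opair_right le_rfl))
    (opair_congr inf_le_left inf_le_right)

theorem isFunName_tildeFun (k : Coding A) {X Y : CondSet A} (f : CondFun X Y) :
    IsFunName (tildeName k X) (tildeName k Y) (tildeFun k f) := by
  refine (isFunName_iff _ _ _).2 ⟨fun z => ?_, fun p => ?_, fun p q q' => ?_⟩
  · refine iSup_le fun u => le_iSup_of_le (pointName k X u)
      (le_iSup_of_le (pointName k Y (f.toFun u)) ?_)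
    refine le_inf (le_inf ?_ ?_) (beq_symm' inf_le_right)
    · rw [mem_tildeName]; exact le_iSup_of_le u (by simp [beq_refl])
    · rw [mem_tildeName]; exact le_iSup_of_le (f.toFun u) (by simp [beq_refl])
  · rw [mem_tildeName]
    refine iSup_le fun u => le_iSup_of_le (pointName k Y (f.toFun u)) ?_
    rw [pairMem_tildeFun]
    exact le_iSup_of_le u (by simp [beq_refl])
  · rw [pairMem_tildeFun, pairMem_tildeFun]
    refine ex_elim inf_le_left fun u => ex_elim (inf_le_left.trans inf_le_right) fun v => ?_
    set G := ((⨆ u, beq (pointName k X u) p ⊓ beq (pointName k Y (f.toFun u)) q) ⊓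
      (⨆ u, beq (pointName k X u) p ⊓ beq (pointName k Y (f.toFun u)) q')) ⊓
      (beq (pointName k X u) p ⊓ beq (pointName k Y (f.toFun u)) q) ⊓
      (beq (pointName k X v) p ⊓ beq (pointName k Y (f.toFun v)) q') with hG
    have h1 : G ≤ beq (pointName k X u) (pointName k X v) :=
      beq_trans' (inf_le_left.trans (inf_le_right.trans inf_le_left))
        (beq_symm' (inf_le_right.trans inf_le_left))
    have h2 : G ≤ beq (pointName k Y (f.toFun u)) (pointName k Y (f.toFun v)) := by
      rw [beq_pointName] at h1 ⊢
      exact h1.trans (f.agree_le u v)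
    refine beq_trans' (beq_symm' ?_) (beq_trans' h2 (inf_le_right.trans inf_le_right))
    exact inf_le_left.trans (inf_le_right.trans inf_le_right)

theorem neEmpty_of_mem {x t : BName A} (h : mem t x = ⊤) : neEmpty x = ⊤ := by
  have h1 : beq x (emptyName A) ≤ mem t (emptyName A) :=
    mem_congr (x := t) (y := x) (by simp [h]) (by simp [beq_refl]) le_rfl
  have h4 : mem t (emptyName A) = ⊥ := iSup_eq_bot.2 fun j => PEmpty.elim j
  rw [h4, le_bot_iff] at h1
  simp [neEmpty, h1]

theorem neEmpty_tildeName (k : Coding A) (X : CondSet A) : neEmpty (tildeName k X) = ⊤ := by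
  obtain ⟨u⟩ := X.nonempty
  refine neEmpty_of_mem (t := pointName k X u) ?_
  rw [mem_tildeName]
  exact top_le_iff.1 (le_iSup_of_le u (by simp [beq_refl]))

/-- The functor `H` with `H(𝐗) = X̃` and `H(𝐟) = f̃`. -/
noncomputable def tildeFunctor (k : Coding A) : CondSet A ⥤ NameCat A where
  obj X := ⟨tildeName k X, neEmpty_tildeName k X⟩
  map f := NameHom.mk (tildeFun k f) (isFunName_tildeFun k f)
  map_id X := by
    refine NameHom.mk_eq fun p q => ?_
    rw [pairMem_tildeFun, pairMem_idName, mem_tildeName, mem_tildeName]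
    refine iSup_le fun u => le_inf (le_inf ?_ ?_) (beq_trans' (beq_symm' inf_le_left) inf_le_right)
    · exact le_iSup_of_le u inf_le_left
    · exact le_iSup_of_le u inf_le_right
  map_comp {X Y Z} f g := by
    refine NameHom.mk_eq fun p q => ?_
    rw [pairMem_compName (isFunName_tildeFun k f) (isFunName_tildeFun k g), pairMem_tildeFun]
    refine iSup_le fun u => le_iSup_of_le (pointName k Y (f.toFun u)) ?_
    rw [pairMem_tildeFun, pairMem_tildeFun]
    refine le_inf (le_iSup_of_le u (le_inf inf_le_left (by simp [beq_refl])))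
      (le_iSup_of_le (f.toFun u) (le_inf (by simp [beq_refl]) inf_le_right))

end CondSets

end BVM

namespace BVM

section Descent

variable {A : Type u} [CompleteBooleanAlgebra A]

/-! The heart of the matter is that a name `x` with `[[x ≠ ∅]] = 1` is recovered from its points,
the names that belong to it with value `1`. Given any name `t`, mixing `t` on `[[t ∈ x]]` with a
fixed point on the complement yields a point that equals `t` at least to the extent `[[t ∈ x]]`
(`exists_desc_of_mem`). Hence `[[t ∈ x]]` is the supremum of `[[u = t]]` over the points `u`
(`mem_eq_iSup_desc`).

This makes `G` fully faithful. A name for a function is determined by its values at points, which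
gives faithfulness. Conversely, a stable map `h` between descents satisfies `[[u = v]] ≤ [[h(u) =
h(v)]]`, because `[[u = v]]` is the agreement value of `u` and `v` in the descent (`agree_descent`)
and stable maps do not decrease agreement. The pairs `(u, h(u))`, all with value `1`, therefore form
a name for a function, and its descent is `h`.

For essential surjectivity, `u ↦ ū` is an isomorphism from `𝐗` to `G(H(𝐗))`. It is injective because
`[[ū = v̄]] = a_{u,v}`, and this value is `1` only for `u = v`. It is surjective because a point of
`X̃` is a mixture of names `ū` along a partition of `1`, hence the image of the corresponding
concatenation in `X` (`toDescentTilde_bijective`).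

These isomorphisms are natural, so `H ⋙ G` is isomorphic to the identity. Since `G` is already an
equivalence, this alone identifies `H` with its quasi-inverse; no isomorphism between `x` and
`H(G(x))` has to be built by hand. -/

/-! ### Agreement values and points of a name -/

theorem CondSet.eq_of_agree_eq_top (X : CondSet A) {u v : X.carrier} (h : agree X u v = ⊤) :
    u = v := by
  -- The supremum defining `agree` is not known to be attained. The elements `b` with `u|b = v|b`
  -- are therefore refined to a partition of `1`; on it `u` and `v` are both concatenations of the
  -- constant family `v`, and concatenations are unique.
  obtain ⟨a, hab, ha⟩ := exists_partition
    (fun b : {b : A // X.restr u b = X.restr v b} => b.1) (by rw [← h, agree, sSup_eq_iSup']; rfl)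
  have hu : ∀ i, X.restr u (a i) = X.restr v (a i) := fun i =>
    X.consistency u v _ _ (hab i) i.2
  exact (X.eq_concat a ha (fun _ => v) u hu).trans
    (X.eq_concat a ha (fun _ => v) v fun _ => rfl).symm

theorem le_agree_of_restr_eq (X : CondSet A) {u v : X.carrier} {a : A}
    (h : X.restr u a = X.restr v a) : a ≤ agree X u v := le_sSup h

/-- In a descent the supremum is attained, since `u|a = v|a` means exactly `a ≤ [[u = v]]`. This
turns facts about agreement in conditional sets into facts about truth values of equality. -/
theorem agree_descent (x : NameCat A) (u v : Desc x.name) :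
    agree (descent x) u v = beq u.rep v.rep :=
  le_antisymm (sSup_le fun _ hb => (condSetoid_iff.1 hb).2)
    (le_agree_of_restr_eq (descent x) (condSetoid_iff.2 ⟨rfl, le_rfl⟩))

/-- In a non-empty name, every name agrees with a point of the descent on the truth value of its
membership. -/
theorem exists_desc_of_mem (x : NameCat A) (t : BName A) :
    ∃ u : Desc x.name, mem t x.name ≤ beq u.rep t := by
  obtain ⟨u₀⟩ := desc_nonempty x.ne_empty
  -- The mixture is `t` on `[[t ∈ x]]` and `u₀` on the complement, so it lies in `x` on both pieces.
  -- The point `u₀` exists because `[[x ≠ ∅]] = 1`.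
  let c : ULift.{u} Bool → A := fun i => if i.down then mem t x.name else (mem t x.name)ᶜ
  let y : ULift.{u} Bool → BName A := fun i => if i.down then t else u₀.rep
  have hc : ∀ i j, i ≠ j → c i ⊓ c j = ⊥ := by
    rintro ⟨i⟩ ⟨j⟩ hij
    cases i <;> cases j <;> simp_all [c]
  have hm : mem (mix c y) x.name = ⊤ := by
    rw [← top_le_iff, ← sup_compl_eq_top (x := mem t x.name)]
    refine sup_le ?_ ?_
    · exact mem_congr (x := t) le_rfl (beq_symm' (mix_spec c hc y ⟨true⟩)) (by simp [beq_refl])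
    · exact mem_congr (x := u₀.rep) (le_top.trans u₀.rep_mem.ge)
        (beq_symm' (mix_spec c hc y ⟨false⟩)) (by simp [beq_refl])
  exact ⟨Desc.mk _ hm, beq_trans' (le_top.trans (Desc.rep_mk _ hm).ge) (mix_spec c hc y ⟨true⟩)⟩

/-- Up to equality with value `1`, `x` is thus the name whose domain consists of its points, all
with value `1`; membership in `x` becomes a supremum over a set of global elements. -/
theorem mem_eq_iSup_desc (x : NameCat A) (t : BName A) :
    mem t x.name = ⨆ u : Desc x.name, beq u.rep t := by
  refine le_antisymm ?_ (iSup_le fun u => ?_)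
  · obtain ⟨u, hu⟩ := exists_desc_of_mem x t
    exact le_iSup_of_le u hu
  · exact mem_congr (x := u.rep) (le_top.trans u.rep_mem.ge) le_rfl (by simp [beq_refl])

/-! ### Descent is faithful and full -/

theorem descentFunctor_faithful : (descentFunctor A).Faithful where
  map_injective {x y} f g h := by
    induction f using Quotient.inductionOn with
    | h f =>
    induction g using Quotient.inductionOn with
    | h g =>
      refine NameHom.mk_eq fun p q => ?_
      -- On `[[(p, q) ∈ f]]` the argument `p` lies in `x`, so it may be replaced by a point `d`,
      -- where the two descended functions have the same value. Only one inclusion between `f` and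
      -- `g` is needed, since both are functions on `x`.
      obtain ⟨d, hd⟩ := exists_desc_of_mem x p
      have hfg : descFun f.2 d = descFun g.2 d := congrFun (congrArg CondFun.toFun h) d
      have hp : pairMem p q f.1 ≤ beq d.rep p := (f.2.dom_cod p q).trans (inf_le_left.trans hd)
      have hq : pairMem p q f.1 ≤ beq (descFun g.2 d).rep q := by
        -- On `[[(p, q) ∈ f]]` both `f↓(d)` and `q` are values of `f` at `d`, so single-valuedness
        -- of `f` identifies them.
        rw [← hfg]
        exact (le_inf (le_top.trans (descFun_spec f.2 d).ge)
          (pairMem_congr le_rfl (beq_symm' hp) (by simp [beq_refl]) (by simp [beq_refl]))).trans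
          (f.2.uniq d.rep _ _)
      exact pairMem_congr (le_top.trans (descFun_spec g.2 d).ge) hp hq (by simp [beq_refl])

/-- The name with domain the pairs `(u, h(u))`, `u ∈ x↓`, and constant value `1`. -/
noncomputable def graphName {x y : NameCat A} (h : CondFun (descent x) (descent y)) : BName A :=
  BName.mk (Desc x.name) (fun u => opair u.rep (Desc.rep (x := y.name) (h.toFun u))) (fun _ => ⊤)

theorem pairMem_graphName {x y : NameCat A} (h : CondFun (descent x) (descent y))
    (p q : BName A) : pairMem p q (graphName h) =
      ⨆ u : Desc x.name, beq u.rep p ⊓ beq (Desc.rep (x := y.name) (h.toFun u)) q := by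
  rw [pairMem_eq]
  change (⨆ u : Desc x.name, ⊤ ⊓ beq (opair u.rep (Desc.rep (x := y.name) (h.toFun u)))
    (opair p q)) = _
  refine iSup_congr fun u => ?_
  rw [top_inf_eq]
  exact le_antisymm (le_inf (opair_left le_rfl) (opair_right le_rfl))
    (opair_congr inf_le_left inf_le_right)

/-- Totality holds because the points exhaust `x` in the sense of `mem_eq_iSup_desc`.
Single-valuedness is where the stability of `h` is needed: two points may be only partially equal,
and their images must then be equal to at least the same extent. -/
theorem isFunName_graphName {x y : NameCat A} (h : CondFun (descent x) (descent y)) :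
    IsFunName x.name y.name (graphName h) := by
  refine (isFunName_iff _ _ _).2 ⟨fun z => ?_, fun p => ?_, fun p q q' => ?_⟩
  · refine iSup_le fun u => le_iSup_of_le u.rep
      (le_iSup_of_le (Desc.rep (x := y.name) (h.toFun u)) ?_)
    refine le_inf (le_inf ?_ ?_) (beq_symm' inf_le_right)
    · exact le_top.trans (Desc.rep_mem (x := x.name) u).ge
    · exact le_top.trans (Desc.rep_mem (x := y.name) (h.toFun u)).ge
  · rw [mem_eq_iSup_desc]
    refine iSup_le fun u => le_iSup_of_le (Desc.rep (x := y.name) (h.toFun u)) ?_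
    rw [pairMem_graphName]
    exact le_iSup_of_le u (by simp [beq_refl])
  · rw [pairMem_graphName, pairMem_graphName]
    refine ex_elim inf_le_left fun u => ex_elim (inf_le_left.trans inf_le_right) fun v => ?_
    have huv : beq u.rep v.rep ≤
        beq (Desc.rep (x := y.name) (h.toFun u)) (Desc.rep (x := y.name) (h.toFun v)) :=
      (agree_descent x u v).ge.trans ((h.agree_le u v).trans (agree_descent y _ _).le)
    -- The chain is `q = h(u) = h(v) = q'`, with the middle equality obtained from `u = p = v`.
    refine beq_trans' (beq_symm' (inf_le_left.trans (inf_le_right.trans inf_le_right)))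
      (beq_trans' (le_trans (beq_trans' ?_ (beq_symm' (inf_le_right.trans inf_le_left))) huv)
        (inf_le_right.trans inf_le_right))
    exact inf_le_left.trans (inf_le_right.trans inf_le_left)

theorem descentFunctor_full : (descentFunctor A).Full where
  map_surjective {x y} h := by
    refine ⟨NameHom.mk (graphName h) (isFunName_graphName h), CondFun.ext' fun u => ?_⟩
    refine descFun_unique (isFunName_graphName h) ?_
    refine (pairMem_graphName h _ _).trans
      (top_le_iff.1 (le_iSup_of_le (show Desc x.name from u) ?_))
    exact le_inf (beq_refl _).ge (beq_refl _).ge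

/-! ### The isomorphism between a conditional set and the descent of its name -/

/-- A bijective conditional function is an isomorphism. -/
noncomputable def CondFun.isoOfBijective {X Y : CondSet A} (f : CondFun X Y)
    (hf : Function.Bijective f.toFun) : X ≅ Y where
  hom := f
  inv := ⟨(Equiv.ofBijective f.toFun hf).symm, fun I a ha y => by
    -- Applying `f` to both sides reduces stability of the inverse to stability of `f`.
    rw [Equiv.symm_apply_eq, Equiv.ofBijective_apply, f.stable]
    congr 1
    funext i
    exact ((Equiv.ofBijective f.toFun hf).apply_symm_apply (y i)).symm⟩
  hom_inv_id := CondFun.ext' (Equiv.ofBijective f.toFun hf).symm_apply_apply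
  inv_hom_id := CondFun.ext' (Equiv.ofBijective f.toFun hf).apply_symm_apply

theorem mem_pointName_tildeName (k : Coding A) (X : CondSet A) (u : X.carrier) :
    mem (pointName k X u) (tildeName k X) = ⊤ := by
  rw [mem_tildeName]
  exact top_le_iff.1 (le_iSup_of_le u (beq_refl _).ge)

theorem beq_rep_mk {x s t : BName A} (hs : mem s x = ⊤) (ht : mem t x = ⊤) :
    beq (Desc.mk s hs).rep (Desc.mk t ht).rep = beq s t := by
  have h1 (G : A) : G ≤ beq (Desc.mk s hs).rep s := le_top.trans (Desc.rep_mk s hs).ge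
  have h2 (G : A) : G ≤ beq (Desc.mk t ht).rep t := le_top.trans (Desc.rep_mk t ht).ge
  exact le_antisymm (beq_trans' (beq_symm' (h1 _)) (beq_trans' le_rfl (h2 _)))
    (beq_trans' (h1 _) (beq_trans' le_rfl (beq_symm' (h2 _))))

/-- The conditional function `𝐗 → X̃↓` with `u ↦ ū`. -/
noncomputable def toDescentTilde (k : Coding A) (X : CondSet A) :
    CondFun X ((tildeFunctor k ⋙ descentFunctor A).obj X) where
  toFun u := Desc.mk (pointName k X u) (mem_pointName_tildeName k X u)
  stable I a ha x := by
    -- By uniqueness of concatenations it suffices to compare on each `a i`, where agreement in `X`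
    -- is the truth value of equality of the point names.
    refine CondSet.eq_concat (descent ((tildeFunctor k).obj X)) a ha _ _ fun i =>
      condSetoid_iff.2 ⟨rfl, ?_⟩
    exact (le_agree_of_restr_eq X (X.concat_spec a ha x i)).trans
      ((beq_pointName k X _ _).ge.trans (beq_rep_mk (mem_pointName_tildeName k X _)
        (mem_pointName_tildeName k X _)).ge)

/-- Injectivity comes from `[[ū = v̄]] = a_{u,v}`. For surjectivity, `[[t ∈ X̃]] = 1` says that the
values `[[ū = t]]` have supremum `1`; a partition `(a_u)` below them, indexed by `X` itself,
presents `t` as the image of `∑ u|a_u`. -/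
theorem toDescentTilde_bijective (k : Coding A) (X : CondSet A) :
    Function.Bijective (toDescentTilde k X).toFun := by
  refine ⟨fun u v h => X.eq_of_agree_eq_top ?_, fun t => ?_⟩
  · have h' := congrArg (fun w : Desc (tildeName k X) => beq w.rep
      (Desc.mk (pointName k X v) (mem_pointName_tildeName k X v)).rep) h
    change beq (Desc.mk (pointName k X u) (mem_pointName_tildeName k X u)).rep _ =
      beq (Desc.mk (pointName k X v) (mem_pointName_tildeName k X v)).rep _ at h'
    rwa [beq_refl, beq_rep_mk, beq_pointName] at h'
  · change Desc (tildeName k X) at t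
    obtain ⟨a, hat, ha⟩ := exists_partition (fun u : X.carrier => beq (pointName k X u) t.rep)
      ((mem_tildeName k X t.rep).symm.trans t.rep_mem)
    refine ⟨X.concat a ha id, Desc.ext (eq_top_of_partition ha fun u => ?_)⟩
    refine beq_trans' (le_top.trans (Desc.rep_mk _ _).ge) (beq_trans' ?_ (hat u))
    rw [beq_pointName]
    exact le_agree_of_restr_eq X (X.concat_spec a ha id u)

/-- The natural isomorphism `𝐗 ≅ G(H(𝐗))`. -/
noncomputable def tildeDescentIso (k : Coding A) :
    𝟭 (CondSet A) ≅ tildeFunctor k ⋙ descentFunctor A :=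
  NatIso.ofComponents
    (fun X => (toDescentTilde k X).isoOfBijective (toDescentTilde_bijective k X))
    (fun {X Y} f => CondFun.ext' fun u => by
      symm
      -- Naturality reduces to the pair `(ū, f(u)‾)` being in `f̃` with value `1`, which holds
      -- because it is in the domain of `f̃`; passing to the chosen representatives costs nothing.
      refine descFun_unique (isFunName_tildeFun k f) ?_
      refine top_le_iff.1 (pairMem_congr (u := pointName k X u)
        (v := pointName k Y (f.toFun u)) (f := tildeFun k f) ?_
        (beq_symm' (Desc.rep_mk _ _).ge) (beq_symm' (Desc.rep_mk _ _).ge) (beq_refl _).ge)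
      rw [pairMem_tildeFun]
      exact le_iSup_of_le u (by simp [beq_refl]))

/-! ### The equivalence and its quasi-inverse -/

theorem descentFunctor_isEquivalence : (descentFunctor A).IsEquivalence where
  faithful := descentFunctor_faithful
  full := descentFunctor_full
  essSurj := ⟨fun X => by
    -- `G` does not involve a coding; any one serves to produce a preimage up to isomorphism.
    obtain ⟨k⟩ := coding_nonempty A
    exact ⟨(tildeFunctor k).obj X, ⟨((tildeDescentIso k).app X).symm⟩⟩⟩

/-- Descent is an equivalence of categories with quasi-inverse `𝐗 ↦ X̃`. -/
noncomputable def descentEquivalence (k : Coding A) : NameCat A ≌ CondSet A :=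
  haveI := descentFunctor_isEquivalence (A := A)
  -- With `G'` the inverse supplied by `asEquivalence`, the chain is `G' ≅ (H ⋙ G) ⋙ G' ≅ H ⋙ (G ⋙
  -- G') ≅ H`. Replacing `G'` along it leaves the functor `G` untouched and makes the inverse `H` by
  -- definition.
  (descentFunctor A).asEquivalence.changeInverse <|
    (Functor.leftUnitor _).symm ≪≫ Functor.isoWhiskerRight (tildeDescentIso k) _ ≪≫
      Functor.associator _ _ _ ≪≫
      Functor.isoWhiskerLeft (tildeFunctor k) (descentFunctor A).asEquivalence.unitIso.symm ≪≫
      Functor.rightUnitor _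

end Descent

end BVM

theorem mainTheorem2 (A : Type u) [CompleteBooleanAlgebra A] :
    (BVM.descentFunctor A).IsEquivalence ∧
      ∀ k : BVM.Coding A, ∃ e : BVM.NameCat A ≌ BVM.CondSet A,
        e.functor = BVM.descentFunctor A ∧ e.inverse = BVM.tildeFunctor k :=
  ⟨BVM.descentFunctor_isEquivalence, fun k => ⟨BVM.descentEquivalence k, rfl, rfl⟩⟩
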